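/- Let $k\ge 2$ and let $\mathcal A_k$ be an alphabet with $k$ letters. For $x\in\mathcal A_k^{\mathbb N}$ or $x\in\mathcal A_k^{\mathbb Z}$ let $F_x$ be the set of its factors (finite subwords, including the empty word) and $F_x(n)$ the set of those of length $n$. A factor $u$ is called right-special if $ua,ub\in F_x$ for two distinct letters $a,b$, left-special if $au,bu\in F_x$ for two distinct letters $a,b$, and bispecial if it is both. The sequence $x$ is an Arnoux–Rauzy (AR) sequence if every factor of $x$ occurs in $x$ with bounded gaps, $|F_x(n)|=(k-1)n+1$ for all $n$, and each $F_x(n)$ contains exactly one right-special and exactly one left-special factor. The associated one-sided (resp. two-sided) AR subshift $X$ is the set of all $y\in\mathcal A_k^{\mathbb N}$ (resp. $\mathcal A_k^{\mathbb Z}$) with $F_y=F_x$, where $x$ is an AR sequence of the same kind; put $F_X=F_x$. The index sequence $(i_n)_{n\ge 1}$ of $X$ is defined as follows: list the bispecial factors as $w_1,w_2,\dots$ with $0=|w_1|<|w_2|<\cdots$; then $i_n$ is the unique letter such that $i_nw_n$ is right-special. For $r\ge 1$, an $r$-run in $(i_n)$ is a pair $(a,l)$, $a\in\mathcal A_k$,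 $l\ge 1$, such that $i_m=a$ for $l\le m\le l+r-1$; it is open if $i_m\ne a$ for $1\le m\le l-1$, and closed otherwise. Let $$\mathrm{ind}(X)=\sup\{p\in\mathbb N:\ u^p\in F_X\text{ for some nonempty word }u\}\in\mathbb N\cup\{\infty\}.$$ **Theorem.** Every one-sided or two-sided AR subshift $X$ over $\mathcal A_k$ has a well-defined (existing and unique) index sequence $(i_n)$, and $$\mathrm{ind}(X)=\max\{N_1,N_2\}$$ in $\mathbb N\cup\{\infty\}$, where $$N_1=1+\sup\{r\ge 1:(i_n)\text{ contains an open }r\text{-run}\},\qquad N_2=2+\sup\{r\ge 1:(i_n)\text{ contains a closed }r\text{-run}\}.$$ -/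

import Mathlib

namespace ArnouxRauzy

/-- The finite word `x_j x_{j+1} ... x_{j+n-1}` read in the sequence `x` at position `j`.
The set of positions `ι` is `ℕ` for one-sided and `ℤ` for two-sided sequences; the alphabet
of `k` letters is `Fin k`. -/
def wordAt {ι : Type} [AddMonoidWithOne ι] {k : ℕ} (x : ι → Fin k) (j : ι) (n : ℕ) :
    List (Fin k) :=
  List.ofFn fun t : Fin n => x (j + ((t : ℕ) : ι))

/-- The set of all factors (finite subwords, including the empty word) of `x`. -/
def factors {ι : Type} [AddMonoidWithOne ι] {k : ℕ} (x : ι → Fin k) : Set (List (Fin k)) :=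
  {u | ∃ j : ι, wordAt x j u.length = u}

/-- `u` has at least two extensions to the right in the language `L`. -/
def IsRightSpecial {k : ℕ} (L : Set (List (Fin k))) (u : List (Fin k)) : Prop :=
  u ∈ L ∧ ∃ a b : Fin k, a ≠ b ∧ u ++ [a] ∈ L ∧ u ++ [b] ∈ L

/-- `u` has at least two extensions to the left in the language `L`. -/
def IsLeftSpecial {k : ℕ} (L : Set (List (Fin k))) (u : List (Fin k)) : Prop :=
  u ∈ L ∧ ∃ a b : Fin k, a ≠ b ∧ a :: u ∈ L ∧ b :: u ∈ L

/-- `u` is both right-special and left-special in the language `L`. -/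
def IsBispecial {k : ℕ} (L : Set (List (Fin k))) (u : List (Fin k)) : Prop :=
  IsRightSpecial L u ∧ IsLeftSpecial L u

/-- Every factor of `x` occurs in `x` with bounded gaps. -/
def IsUniformlyRecurrent {ι : Type} [AddMonoidWithOne ι] {k : ℕ} (x : ι → Fin k) : Prop :=
  ∀ u ∈ factors x, ∃ G : ℕ, ∀ j : ι, ∃ t : ℕ, t < G ∧ wordAt x (j + (t : ι)) u.length = u

/-- Arnoux-Rauzy sequences over the alphabet of `k` letters (`k ≥ 2`). -/
structure IsARSequence {ι : Type} [AddMonoidWithOne ι] {k : ℕ} (x : ι → Fin k) : Prop where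
  uniformlyRecurrent : IsUniformlyRecurrent x
  complexity : ∀ n : ℕ, {u ∈ factors x | u.length = n}.ncard = (k - 1) * n + 1
  rightSpecial : ∀ n : ℕ, ∃! u : List (Fin k), u.length = n ∧ IsRightSpecial (factors x) u
  leftSpecial : ∀ n : ℕ, ∃! u : List (Fin k), u.length = n ∧ IsLeftSpecial (factors x) u

/-- `X` is the subshift of all sequences having the same factors as some Arnoux-Rauzy
sequence `x`. -/
def IsARSubshift {ι : Type} [AddMonoidWithOne ι] {k : ℕ} (X : Set (ι → Fin k)) : Prop :=
  ∃ x : ι → Fin k, IsARSequence x ∧ X = {y | factors y = factors x}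

/-- The set of factors of (the elements of) `X`. -/
def language {ι : Type} [AddMonoidWithOne ι] {k : ℕ} (X : Set (ι → Fin k)) :
    Set (List (Fin k)) :=
  {u | ∃ y ∈ X, u ∈ factors y}

/-- `i` is the index sequence of the language `L`: if `w 0, w 1, w 2, ...` are the bispecial
words of `L` listed by strictly increasing length, then `i n` is the unique letter such that
the word `i n` followed by `w n` is right-special. Sequences are numbered from `0`. -/
def IsIndexSequence {k : ℕ} (L : Set (List (Fin k))) (i : ℕ → Fin k) : Prop :=
  ∃ w : ℕ → List (Fin k),
    StrictMono (fun n => (w n).length) ∧ Set.range w = {u | IsBispecial L u} ∧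
      ∀ n, ∀ a : Fin k, IsRightSpecial L (a :: w n) ↔ a = i n

/-- The power `u^p`, the concatenation of `p` copies of `u`. -/
def wordPow {k : ℕ} (u : List (Fin k)) (p : ℕ) : List (Fin k) :=
  (List.replicate p u).flatten

/-- The integer index of `X`: the supremum, in `ℕ ∪ {∞}`, of the exponents of the powers of
nonempty words that are factors of `X`. -/
noncomputable def ind {ι : Type} [AddMonoidWithOne ι] {k : ℕ} (X : Set (ι → Fin k)) : ℕ∞ :=
  ⨆ (p : ℕ) (_ : ∃ u : List (Fin k), u ≠ [] ∧ wordPow u p ∈ language X), (p : ℕ∞)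

/-- `(a, l)` is an `r`-run of `i` (not necessarily a maximal one), `r ≥ 1`. -/
def IsRun {k : ℕ} (i : ℕ → Fin k) (r : ℕ) (a : Fin k) (l : ℕ) : Prop :=
  1 ≤ r ∧ ∀ m, l ≤ m → m < l + r → i m = a

/-- An `r`-run `(a, l)` is open if `a` does not occur in `i` before position `l`. -/
def IsOpenRun {k : ℕ} (i : ℕ → Fin k) (r : ℕ) (a : Fin k) (l : ℕ) : Prop :=
  IsRun i r a l ∧ ∀ m, m < l → i m ≠ a

/-- An `r`-run is closed if it is not open. -/
def IsClosedRun {k : ℕ} (i : ℕ → Fin k) (r : ℕ) (a : Fin k) (l : ℕ) : Prop :=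
  IsRun i r a l ∧ ¬ IsOpenRun i r a l

/-- `1` plus the supremum of the lengths of the open runs of `i`. -/
noncomputable def openBound {k : ℕ} (i : ℕ → Fin k) : ℕ∞ :=
  1 + ⨆ (r : ℕ) (_ : ∃ (a : Fin k) (l : ℕ), IsOpenRun i r a l), (r : ℕ∞)

/-- `2` plus the supremum of the lengths of the closed runs of `i`. -/
noncomputable def closedBound {k : ℕ} (i : ℕ → Fin k) : ℕ∞ :=
  2 + ⨆ (r : ℕ) (_ : ∃ (a : Fin k) (l : ℕ), IsClosedRun i r a l), (r : ℕ∞)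

end ArnouxRauzy

/-!
The proof desubstitutes the language of the subshift. An Arnoux-Rauzy language has a unique letter
`a` that is right-special, and the same letter is left-special (`exists_isSpecialLetter`). Hence of
any two consecutive letters at least one is `a`, and every word is, up to its ends, a
concatenation of the blocks `a` and `ab` with `b ≠ a`. Writing these blocks as the letters `a` and
`b` yields the language `derived L a`, again an Arnoux-Rauzy language (`IsARLanguage.derived`). The
map `v ↦ lift a v`, the image of `v` under `b ↦ ab`, `a ↦ a` followed by `a`, is a bijection from
its bispecial words to the nonempty bispecial words of `L`; so `a` is the first index, and the
index sequence of the derived language is the shifted one (`isIndexSequence_derived`).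

After `n` desubstitutions, a word `v` of the language `level L i n` codes the word
`expand i n v ++ bispecialWord i n` of `L`. A run of `r` equal indices `a` at position `l` means that
`a ^ (r + 1)` is in `level L i l`, so that `L` contains the power of the return word `u` coded
by `a` with exponent `r + 1`, followed by the bispecial word. When `a` has occurred among the first
`l` indices, `u` is a prefix of that bispecial word (`returnWord_prefix`), and `u ^ (r + 2)` is
in `L`.

Conversely, if `u ^ p` is in `L` with `p ≥ 3`, it is extended to the form `lift a z` as long as its
period word contains two letters, and desubstituted. The period word gets shorter and ends up as a
single letter `c`. Comparing the lengths of the return word coded by `c` and of the bispecial word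
bounds the exponent of `c` from below, which gives a closed run of length `p - 2`
(`exists_isClosedRun_of_periodic`). Thus the index is the bound given by the closed runs. The bound
given by the open runs never exceeds it, because it is at
least 2, and an open run of length at least 2 becomes closed when its first term is dropped.
-/

namespace ArnouxRauzy

variable {k : ℕ} {L : Set (List (Fin k))} {a : Fin k} {i : ℕ → Fin k}

/-! ### Reversal and Arnoux-Rauzy languages -/

/-- The language of the reversals of the words of `L`. -/
def rev (L : Set (List (Fin k))) : Set (List (Fin k)) := {u | u.reverse ∈ L}

theorem rev_rev (L : Set (List (Fin k))) : rev (rev L) = L := by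
  ext u; simp [rev]

theorem isRightSpecial_rev {u : List (Fin k)} :
    IsRightSpecial (rev L) u ↔ IsLeftSpecial L u.reverse := by
  simp [IsRightSpecial, IsLeftSpecial, rev]

theorem isLeftSpecial_rev {u : List (Fin k)} :
    IsLeftSpecial (rev L) u ↔ IsRightSpecial L u.reverse := by
  simp [IsRightSpecial, IsLeftSpecial, rev]

theorem isLeftSpecial_iff_rev {u : List (Fin k)} :
    IsLeftSpecial L u ↔ IsRightSpecial (rev L) u.reverse := by
  simp [isRightSpecial_rev]

/-- The right-special words of `L` form an infinite chain for the suffix order, and each of them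
is followed by every letter. -/
structure IsRightRegular (L : Set (List (Fin k))) : Prop where
  append_mem : ∀ u, IsRightSpecial L u → ∀ c, u ++ [c] ∈ L
  suffix_of_length_le : ∀ u v, IsRightSpecial L u → IsRightSpecial L v →
    u.length ≤ v.length → u <:+ v
  unbounded : ∀ n : ℕ, ∃ u, IsRightSpecial L u ∧ n ≤ u.length

/-- The properties of the language of an Arnoux-Rauzy sequence that are inherited by its
desubstitution: it is factorial and irreducible, and its right-special and left-special words
are as prescribed by `IsRightRegular`. -/
structure IsARLanguage (L : Set (List (Fin k))) : Prop where
  mem_of_infix : ∀ {u v}, v ∈ L → u <:+: v → u ∈ L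
  irreducible : ∀ u ∈ L, ∀ v ∈ L, ∃ w, u ++ w ++ v ∈ L
  right : IsRightRegular L
  left : IsRightRegular (rev L)

namespace IsARLanguage

theorem rev (h : IsARLanguage L) : IsARLanguage (rev L) where
  mem_of_infix := fun hv huv => h.mem_of_infix hv (List.reverse_infix.2 huv)
  irreducible := fun u hu v hv => by
    obtain ⟨w, hw⟩ := h.irreducible _ hv _ hu
    exact ⟨w.reverse, by simpa [ArnouxRauzy.rev] using hw⟩
  right := h.left
  left := by rw [rev_rev]; exact h.right

theorem isRightSpecial_of_suffix (h : IsARLanguage L) {u v : List (Fin k)}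
    (hv : IsRightSpecial L v) (huv : u <:+ v) : IsRightSpecial L u := by
  obtain ⟨hv, b, c, hbc, hb, hc⟩ := hv
  obtain ⟨t, rfl⟩ := huv
  exact ⟨h.mem_of_infix hv (List.suffix_append _ _).isInfix, b, c, hbc,
    h.mem_of_infix hb ⟨t, [], by simp⟩, h.mem_of_infix hc ⟨t, [], by simp⟩⟩

theorem exists_isRightSpecial (h : IsARLanguage L) (n : ℕ) :
    ∃ u, IsRightSpecial L u ∧ u.length = n := by
  obtain ⟨u, hu, hn⟩ := h.right.unbounded n
  exact ⟨u.drop (u.length - n), h.isRightSpecial_of_suffix hu (List.drop_suffix _ _), by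
    simp; omega⟩

theorem isRightSpecial_unique (h : IsARLanguage L) {u v : List (Fin k)}
    (hu : IsRightSpecial L u) (hv : IsRightSpecial L v) (huv : u.length = v.length) : u = v :=
  (h.right.suffix_of_length_le u v hu hv huv.le).eq_of_length huv

theorem isRightSpecial_nil (h : IsARLanguage L) : IsRightSpecial L [] := by
  obtain ⟨u, hu, hn⟩ := h.exists_isRightSpecial 0
  rwa [List.length_eq_zero_iff.1 hn] at hu

theorem singleton_mem (h : IsARLanguage L) (c : Fin k) : [c] ∈ L :=
  h.right.append_mem [] h.isRightSpecial_nil c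

theorem isBispecial_nil (h : IsARLanguage L) : IsBispecial L [] :=
  ⟨h.isRightSpecial_nil, isLeftSpecial_iff_rev.2 h.rev.isRightSpecial_nil⟩

theorem exists_append_mem (h : IsARLanguage L) {u : List (Fin k)} (hu : u ∈ L) :
    ∃ c, u ++ [c] ∈ L := by
  obtain ⟨r, ⟨-, b, -⟩, -⟩ := h.right.unbounded 0
  obtain ⟨w, hw⟩ := h.irreducible u hu [b] (h.singleton_mem b)
  cases w with
  | nil => exact ⟨b, by simpa using hw⟩
  | cons c w => exact ⟨c, h.mem_of_infix hw ⟨[], w ++ [b], by simp⟩⟩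

theorem exists_cons_mem (h : IsARLanguage L) {u : List (Fin k)} (hu : u ∈ L) :
    ∃ c, c :: u ∈ L := by
  obtain ⟨c, hc⟩ := h.rev.exists_append_mem (u := u.reverse) (by simpa [ArnouxRauzy.rev] using hu)
  exact ⟨c, by simpa [ArnouxRauzy.rev] using hc⟩

end IsARLanguage

/-! ### The special letter -/

/-- `a`, as a word of length one, is bispecial in `L`. -/
abbrev IsSpecialLetter (L : Set (List (Fin k))) (a : Fin k) : Prop := IsBispecial L [a]

theorem IsSpecialLetter.rev (ha : IsSpecialLetter L a) : IsSpecialLetter (rev L) a :=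
  ⟨isRightSpecial_rev.2 ha.2, isLeftSpecial_rev.2 ha.1⟩

namespace IsARLanguage

/-- The right-special letter `a` and the left-special letter `b` agree: otherwise `b`, which
precedes itself and is not right-special, would be followed by `b` only, and never by `a`. -/
theorem exists_isSpecialLetter (h : IsARLanguage L) : ∃ a, IsSpecialLetter L a := by
  obtain ⟨u, hu, hu1⟩ := h.exists_isRightSpecial 1
  obtain ⟨v, hv, hv1⟩ := h.rev.exists_isRightSpecial 1
  obtain ⟨a, rfl⟩ := List.length_eq_one_iff.1 hu1
  obtain ⟨b, rfl⟩ := List.length_eq_one_iff.1 hv1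
  by_cases hab : a = b
  · subst hab
    exact ⟨a, hu, isRightSpecial_rev.1 hv⟩
  exfalso
  have hbb : [b, b] ∈ L := by simpa [ArnouxRauzy.rev] using h.left.append_mem _ hv b
  have hb : ∀ c, [b, c] ∈ L → c = b := by
    intro c hc
    by_contra hcb
    have := h.isRightSpecial_unique hu ⟨h.singleton_mem b, c, b, hcb, hc, hbb⟩ rfl
    simp_all
  have key : ∀ w, b :: w ∈ L → ∀ c ∈ w, c = b := by
    intro w
    induction w with
    | nil => simp
    | cons d w ih =>
      intro hw
      obtain rfl := hb d (h.mem_of_infix hw ⟨[], w, by simp⟩)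
      have := ih (h.mem_of_infix hw ⟨[d], [], by simp⟩)
      simpa using this
  obtain ⟨w, hw⟩ := h.irreducible [b] (h.singleton_mem b) [a] (h.singleton_mem a)
  exact hab (key (w ++ [a]) (by simpa using hw) a (by simp))

theorem eq_or_eq_of_pair_mem (h : IsARLanguage L) (ha : IsSpecialLetter L a) {b c : Fin k}
    (hbc : [b, c] ∈ L) : b = a ∨ c = a := by
  by_contra! hne
  have hba : [b, a] ∈ L := by
    simpa [ArnouxRauzy.rev] using h.left.append_mem [a] (isRightSpecial_rev.2 ha.2) b
  have := h.isRightSpecial_unique ha.1 ⟨h.singleton_mem b, c, a, hne.2, hbc, hba⟩ rfl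
  simp_all

theorem isChain_of_mem (h : IsARLanguage L) (ha : IsSpecialLetter L a) :
    ∀ z ∈ L, List.IsChain (fun b c => b = a ∨ c = a) z
  | [], _ => .nil
  | [_], _ => .singleton _
  | b :: c :: z, hz => .cons_cons
      (h.eq_or_eq_of_pair_mem ha (h.mem_of_infix hz ⟨[], z, by simp⟩))
      (h.isChain_of_mem ha (c :: z) (h.mem_of_infix hz ⟨[b], [], by simp⟩))

theorem append_singleton_mem (h : IsARLanguage L) (ha : IsSpecialLetter L a)
    {u : List (Fin k)} {b : Fin k} (hb : b ≠ a) (hu : u ++ [b] ∈ L) : u ++ [b] ++ [a] ∈ L := by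
  obtain ⟨c, hc⟩ := h.exists_append_mem hu
  have := h.eq_or_eq_of_pair_mem ha (b := b) (c := c) (h.mem_of_infix hc ⟨u, [], by simp⟩)
  obtain rfl : c = a := by tauto
  exact hc

theorem cons_mem (h : IsARLanguage L) (ha : IsSpecialLetter L a)
    {u : List (Fin k)} {b : Fin k} (hb : b ≠ a) (hu : b :: u ∈ L) : a :: b :: u ∈ L := by
  obtain ⟨c, hc⟩ := h.exists_cons_mem hu
  have := h.eq_or_eq_of_pair_mem ha (b := c) (c := b) (h.mem_of_infix hc ⟨[], u, by simp⟩)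
  obtain rfl : c = a := by tauto
  exact hc

end IsARLanguage

/-! ### The substitutions `a ↦ a`, `b ↦ ab` -/

/-- The substitution which puts the letter `a` before every letter other than `a`. -/
def subst (a : Fin k) (v : List (Fin k)) : List (Fin k) :=
  v.flatMap fun c => if c = a then [a] else [a, c]

/-- The image of a word under `subst a`, completed by the letter `a` with which the image of the
next letter has to begin. -/
def lift (a : Fin k) (v : List (Fin k)) : List (Fin k) := subst a v ++ [a]

@[simp] theorem subst_nil : subst a [] = [] := rfl

theorem subst_cons_self (v : List (Fin k)) : subst a (a :: v) = a :: subst a v := by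
  simp [subst]

theorem subst_cons_of_ne {c : Fin k} (hc : c ≠ a) (v : List (Fin k)) :
    subst a (c :: v) = a :: c :: subst a v := by
  simp [subst, hc]

@[simp] theorem subst_append (u v : List (Fin k)) :
    subst a (u ++ v) = subst a u ++ subst a v := by
  simp [subst]

@[simp] theorem lift_nil : lift a [] = [a] := rfl

theorem lift_cons_self (v : List (Fin k)) : lift a (a :: v) = a :: lift a v := by
  simp [lift, subst_cons_self]

theorem lift_cons_of_ne {c : Fin k} (hc : c ≠ a) (v : List (Fin k)) :
    lift a (c :: v) = a :: c :: lift a v := by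
  simp [lift, subst_cons_of_ne hc]

theorem lift_append (u v : List (Fin k)) : lift a (u ++ v) = subst a u ++ lift a v := by
  simp [lift]

theorem exists_lift_eq_cons (v : List (Fin k)) : ∃ t, lift a v = a :: t := by
  cases v with
  | nil => exact ⟨[], rfl⟩
  | cons c v =>
    by_cases hc : c = a
    · subst hc; exact ⟨_, lift_cons_self v⟩
    · exact ⟨_, lift_cons_of_ne hc v⟩

theorem lift_append_singleton_self (v : List (Fin k)) : lift a (v ++ [a]) = lift a v ++ [a] := by
  simp [lift, subst_cons_self]

theorem lift_append_singleton_of_ne {c : Fin k} (hc : c ≠ a) (v : List (Fin k)) :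
    lift a (v ++ [c]) = lift a v ++ [c] ++ [a] := by
  simp [lift, subst_cons_of_ne hc]

theorem lift_reverse (v : List (Fin k)) : lift a v.reverse = (lift a v).reverse := by
  induction v with
  | nil => rfl
  | cons c v ih =>
    by_cases hc : c = a
    · subst hc; simp [lift_append_singleton_self, lift_cons_self, ih]
    · simp [lift_append_singleton_of_ne hc, lift_cons_of_ne hc, ih]

theorem length_le_length_subst (v : List (Fin k)) : v.length ≤ (subst a v).length := by
  induction v with
  | nil => simp
  | cons c v ih =>
    by_cases hc : c = a
    · subst hc; simpa [subst_cons_self] using ih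
    · simp [subst_cons_of_ne hc]; omega

theorem length_lt_length_subst {v : List (Fin k)} {b : Fin k} (hb : b ∈ v) (hba : b ≠ a) :
    v.length < (subst a v).length := by
  obtain ⟨s, t, rfl⟩ := List.append_of_mem hb
  have hs := length_le_length_subst (a := a) s
  have ht := length_le_length_subst (a := a) t
  simp [subst_cons_of_ne hba]; omega

theorem length_subst_le (v : List (Fin k)) : (subst a v).length ≤ 2 * v.length := by
  induction v with
  | nil => simp
  | cons c v ih =>
    by_cases hc : c = a
    · subst hc; simp [subst_cons_self]; omega
    · simp [subst_cons_of_ne hc]; omega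

theorem length_lift (v : List (Fin k)) : (lift a v).length = (subst a v).length + 1 := by
  simp [lift]

theorem mem_of_mem_subst {v : List (Fin k)} {b : Fin k} (hb : b ∈ subst a v) (hba : b ≠ a) :
    b ∈ v := by
  simp only [subst, List.mem_flatMap] at hb
  obtain ⟨c, hc, hb⟩ := hb
  split_ifs at hb <;> simp_all

/-- A word ends at the boundary of two blocks `a` or `ab` as soon as it is followed by `a`. -/
theorem exists_eq_subst : ∀ z : List (Fin k),
    List.IsChain (fun b c => b = a ∨ c = a) (z ++ [a]) → (z ++ [a]).head? = some a →
    ∃ v, z = subst a v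
  | [], _, _ => ⟨[], rfl⟩
  | [b], _, hz => ⟨[a], by simp at hz; simp [subst, hz]⟩
  | b :: c :: z, hz, hb => by
    obtain rfl : a = b := by simpa [eq_comm] using hb
    by_cases hc : a = c
    · subst hc
      obtain ⟨v, hv⟩ := exists_eq_subst (a :: z) hz.tail rfl
      exact ⟨a :: v, by rw [subst_cons_self, hv]⟩
    · have h2 : (z ++ [a]).head? = some a := by
        cases z with
        | nil => rfl
        | cons d z =>
          have h2 := hz.tail
          simp only [List.cons_append, List.isChain_cons_cons, List.tail_cons] at h2
          have : d = a := by tauto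
          simp [this]
      obtain ⟨v, hv⟩ := exists_eq_subst z hz.tail.tail h2
      exact ⟨c :: v, by rw [subst_cons_of_ne (Ne.symm hc), hv]⟩

theorem exists_eq_lift {z : List (Fin k)}
    (hz : List.IsChain (fun b c => b = a ∨ c = a) z) (h1 : [a] <+: z) (h2 : [a] <:+ z) :
    ∃ v, z = lift a v := by
  obtain ⟨y, rfl⟩ := h2
  obtain ⟨t, ht⟩ := h1
  obtain ⟨v, rfl⟩ := exists_eq_subst y hz (by simp [← ht])
  exact ⟨v, rfl⟩

theorem prefix_of_lift_prefix : ∀ u v : List (Fin k), lift a u <+: lift a v → u <+: v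
  | [], _, _ => List.nil_prefix
  | c :: u, [], h => by
    have := h.length_le
    have h2 := length_le_length_subst (a := a) (c :: u)
    simp only [length_lift, List.length_cons, subst_nil, List.length_nil] at this h2
    omega
  | c :: u, d :: v, h => by
    obtain ⟨s, hs⟩ := exists_lift_eq_cons (a := a) u
    obtain ⟨t, ht⟩ := exists_lift_eq_cons (a := a) v
    by_cases hc : a = c <;> by_cases hd : a = d
    · subst hc hd
      rw [lift_cons_self, lift_cons_self, List.cons_prefix_cons] at h
      exact List.cons_prefix_cons.2 ⟨rfl, prefix_of_lift_prefix u v h.2⟩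
    · subst hc
      rw [lift_cons_self, lift_cons_of_ne (Ne.symm hd), hs] at h
      simp only [List.cons_prefix_cons] at h
      exact absurd h.2.1 hd
    · subst hd
      rw [lift_cons_self, lift_cons_of_ne (Ne.symm hc), ht] at h
      simp only [List.cons_prefix_cons] at h
      exact absurd h.2.1.symm hc
    · rw [lift_cons_of_ne (Ne.symm hc), lift_cons_of_ne (Ne.symm hd)] at h
      simp only [List.cons_prefix_cons] at h
      exact List.cons_prefix_cons.2 ⟨h.2.1, prefix_of_lift_prefix u v h.2.2⟩

theorem lift_injective : Function.Injective (lift a : List (Fin k) → List (Fin k)) := by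
  intro u v h
  have huv : lift a u <+: lift a v := by rw [h]
  have hvu : lift a v <+: lift a u := by rw [h]
  exact (prefix_of_lift_prefix u v huv).eq_of_length_le (prefix_of_lift_prefix v u hvu).length_le

theorem suffix_of_lift_suffix {u v : List (Fin k)} (h : lift a u <:+ lift a v) : u <:+ v := by
  rw [← List.reverse_prefix, ← lift_reverse, ← lift_reverse] at h
  exact List.reverse_prefix.1 (prefix_of_lift_prefix _ _ h)

theorem lift_infix {u v : List (Fin k)} (h : u <:+: v) : lift a u <:+: lift a v := by
  obtain ⟨s, t, rfl⟩ := h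
  obtain ⟨r, hr⟩ := exists_lift_eq_cons (a := a) t
  exact ⟨subst a s, r, by rw [lift_append, hr]; simp [lift]⟩

/-! ### Desubstitution of a language -/

/-- The desubstitution of `L`: the words whose images under `subst a`, followed by `a`, are
in `L`. -/
def derived (L : Set (List (Fin k))) (a : Fin k) : Set (List (Fin k)) := {v | lift a v ∈ L}

theorem rev_derived : rev (derived L a) = derived (rev L) a := by
  ext v; simp [rev, derived, lift_reverse]

namespace IsARLanguage

theorem append_singleton_mem_derived (h : IsARLanguage L) (ha : IsSpecialLetter L a)
    {v : List (Fin k)} {c : Fin k} : v ++ [c] ∈ derived L a ↔ lift a v ++ [c] ∈ L := by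
  by_cases hc : c = a
  · subst hc
    simp [derived, lift_append_singleton_self]
  · simp only [derived, Set.mem_ofPred_eq, lift_append_singleton_of_ne hc]
    exact ⟨fun hm => h.mem_of_infix hm (List.prefix_append _ _).isInfix,
      h.append_singleton_mem ha hc⟩

theorem isRightSpecial_derived (h : IsARLanguage L) (ha : IsSpecialLetter L a)
    {v : List (Fin k)} : IsRightSpecial (derived L a) v ↔ IsRightSpecial L (lift a v) := by
  simp only [IsRightSpecial, h.append_singleton_mem_derived ha]
  rfl

theorem isLeftSpecial_derived (h : IsARLanguage L) (ha : IsSpecialLetter L a)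
    {v : List (Fin k)} : IsLeftSpecial (derived L a) v ↔ IsLeftSpecial L (lift a v) := by
  rw [isLeftSpecial_iff_rev, isLeftSpecial_iff_rev, rev_derived,
    h.rev.isRightSpecial_derived ha.rev, lift_reverse]

theorem isBispecial_derived (h : IsARLanguage L) (ha : IsSpecialLetter L a)
    {v : List (Fin k)} : IsBispecial (derived L a) v ↔ IsBispecial L (lift a v) :=
  and_congr (h.isRightSpecial_derived ha) (h.isLeftSpecial_derived ha)

theorem isRightSpecial_derived_cons (h : IsARLanguage L) (ha : IsSpecialLetter L a)
    {v : List (Fin k)} {c : Fin k} :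
    IsRightSpecial (derived L a) (c :: v) ↔ IsRightSpecial L (c :: lift a v) := by
  rw [h.isRightSpecial_derived ha]
  by_cases hc : c = a
  · subst hc
    rw [lift_cons_self]
  · rw [lift_cons_of_ne hc]
    refine ⟨fun hr => h.isRightSpecial_of_suffix hr (List.suffix_cons _ _), ?_⟩
    rintro ⟨hm, b, d, hbd, hb, hd⟩
    exact ⟨h.cons_mem ha hc hm, b, d, hbd, h.cons_mem ha hc hb, h.cons_mem ha hc hd⟩

theorem singleton_suffix (h : IsARLanguage L) (ha : IsSpecialLetter L a) {z : List (Fin k)}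
    (hz : IsRightSpecial L z) (hz0 : z ≠ []) : [a] <:+ z :=
  h.right.suffix_of_length_le _ _ ha.1 hz (List.length_pos_iff.2 hz0)

theorem isRightRegular_derived (h : IsARLanguage L) (ha : IsSpecialLetter L a) :
    IsRightRegular (derived L a) where
  append_mem := fun u hu c => (h.append_singleton_mem_derived ha).2
    (h.right.append_mem _ ((h.isRightSpecial_derived ha).1 hu) c)
  suffix_of_length_le := fun u v hu hv huv => by
    rw [h.isRightSpecial_derived ha] at hu hv
    rcases le_total (lift a u).length (lift a v).length with hl | hl
    · exact suffix_of_lift_suffix (h.right.suffix_of_length_le _ _ hu hv hl)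
    · have hs := suffix_of_lift_suffix (h.right.suffix_of_length_le _ _ hv hu hl)
      rw [hs.eq_of_length (le_antisymm hs.length_le huv)]
  unbounded := fun n => by
    obtain ⟨z, hz, hn⟩ := h.exists_isRightSpecial (2 * n + 3)
    -- The word `z` is brought to the form `lift a v` by dropping its first letter if it is not `a`.
    obtain ⟨y, hy, hyn, hya⟩ : ∃ y, IsRightSpecial L y ∧ 2 * n + 2 ≤ y.length ∧ [a] <+: y := by
      rcases z with _ | ⟨b, _ | ⟨c, z⟩⟩
      · simp at hn
      · simp at hn
      · by_cases hb : b = a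
        · exact ⟨_, hz, by omega, by simp [hb]⟩
        · have := h.eq_or_eq_of_pair_mem ha (b := b) (c := c)
            (h.mem_of_infix hz.1 ⟨[], z, by simp⟩)
          exact ⟨c :: z, h.isRightSpecial_of_suffix hz (List.suffix_cons _ _),
            by simp at hn ⊢; omega, by simp; tauto⟩
    obtain ⟨v, rfl⟩ := exists_eq_lift (h.isChain_of_mem ha y hy.1) hya
      (h.singleton_suffix ha hy (by rintro rfl; simp at hyn))
    refine ⟨v, (h.isRightSpecial_derived ha).2 hy, ?_⟩
    have := length_subst_le (a := a) v
    rw [length_lift] at hyn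
    omega

/-- Being an Arnoux-Rauzy language is inherited by the desubstitution along the special letter. -/
theorem derived (h : IsARLanguage L) (ha : IsSpecialLetter L a) :
    IsARLanguage (derived L a) where
  mem_of_infix := fun hv huv => h.mem_of_infix hv (lift_infix huv)
  irreducible := fun u hu v hv => by
    obtain ⟨w, hw⟩ := h.irreducible _ hu _ hv
    -- Between `subst a u` and `lift a v` there is a word that starts with `a` and is followed
    -- by `a`, hence a concatenation of blocks.
    obtain ⟨s, hs⟩ := exists_lift_eq_cons (a := a) v
    obtain ⟨y, hy⟩ := exists_eq_subst (a := a) (a :: w)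
      (h.isChain_of_mem ha _ (h.mem_of_infix hw ⟨subst a u, s, by rw [hs]; simp [lift]⟩)) rfl
    exact ⟨y, by simpa [ArnouxRauzy.derived, lift_append, ← hy, lift] using hw⟩
  right := h.isRightRegular_derived ha
  left := by
    rw [rev_derived]
    exact h.rev.isRightRegular_derived ha.rev

theorem exists_eq_lift_of_isBispecial (h : IsARLanguage L) (ha : IsSpecialLetter L a)
    {z : List (Fin k)} (hz : IsBispecial L z) (hz0 : z ≠ []) : ∃ v, z = lift a v := by
  refine exists_eq_lift (h.isChain_of_mem ha z hz.1.1) ?_ (h.singleton_suffix ha hz.1 hz0)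
  have := h.rev.singleton_suffix ha.rev (isLeftSpecial_iff_rev.1 hz.2) (by simpa)
  simpa using List.reverse_prefix.2 this

/-! ### The index sequence -/

theorem exists_isBispecial (n : ℕ) : ∀ {L : Set (List (Fin k))}, IsARLanguage L →
    ∃ u, IsBispecial L u ∧ n ≤ u.length := by
  induction n with
  | zero => exact fun h => ⟨[], h.isBispecial_nil, le_rfl⟩
  | succ n ih =>
    intro L h
    obtain ⟨a, ha⟩ := h.exists_isSpecialLetter
    obtain ⟨v, hv, hn⟩ := ih (h.derived ha)
    refine ⟨lift a v, (h.isBispecial_derived ha).1 hv, ?_⟩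
    have := length_le_length_subst (a := a) v
    rw [length_lift]
    omega

theorem exists_isIndexSequence (h : IsARLanguage L) : ∃ i, IsIndexSequence L i := by
  classical
  let S : Set ℕ := {n | ∃ u, IsBispecial L u ∧ u.length = n}
  have hS : S.Infinite := Set.infinite_of_forall_exists_gt fun n => by
    obtain ⟨u, hu, hn⟩ := exists_isBispecial (n + 1) h
    exact ⟨u.length, ⟨u, hu, rfl⟩, hn⟩
  have := hS.to_subtype
  have hmem : ∀ n, Nat.orderEmbeddingOfSet S n ∈ S := fun n =>
    (Nat.orderEmbeddingOfSet_range S).le (Set.mem_range_self n)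
  choose w hw hwl using hmem
  have hex : ∀ n, ∃ c, ∀ b, IsRightSpecial L (b :: w n) ↔ b = c := fun n => by
    obtain ⟨u, hu, hun⟩ := h.exists_isRightSpecial ((w n).length + 1)
    obtain ⟨c, t, rfl⟩ := List.exists_cons_of_length_eq_add_one hun
    obtain rfl : t = w n := h.isRightSpecial_unique
      (h.isRightSpecial_of_suffix hu (List.suffix_cons _ _)) (hw n).1 (by simpa using hun)
    refine ⟨c, fun b => ⟨fun hb => ?_, fun hb => hb ▸ hu⟩⟩
    simpa using h.isRightSpecial_unique hb hu rfl
  choose i hi using hex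
  refine ⟨i, w, ?_, ?_, hi⟩
  · simp only [hwl]
    exact (Nat.orderEmbeddingOfSet S).strictMono
  · ext u
    refine ⟨?_, fun hu => ?_⟩
    · rintro ⟨n, rfl⟩
      exact hw n
    · have : u.length ∈ Set.range (Nat.orderEmbeddingOfSet S) := by
        rw [Nat.orderEmbeddingOfSet_range]; exact ⟨u, hu, rfl⟩
      obtain ⟨n, hn⟩ := this
      exact ⟨n, h.isRightSpecial_unique (hw n).1 hu.1 ((hwl n).trans hn)⟩

/-- Desubstitution removes the first bispecial word and the first index. -/
theorem isIndexSequence_derived (h : IsARLanguage L) {i : ℕ → Fin k}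
    (hi : IsIndexSequence L i) :
    IsSpecialLetter L (i 0) ∧
      IsIndexSequence (ArnouxRauzy.derived L (i 0)) fun n => i (n + 1) := by
  obtain ⟨w, hmono, hrange, hw⟩ := hi
  have hw0 : w 0 = [] := by
    obtain ⟨m, hm⟩ : [] ∈ Set.range w := by rw [hrange]; exact h.isBispecial_nil
    have := hmono.monotone (Nat.zero_le m)
    simpa [hm] using this
  obtain ⟨a, ha⟩ := h.exists_isSpecialLetter
  obtain rfl : a = i 0 := (hw 0 a).1 (by rw [hw0]; exact ha.1)
  refine ⟨ha, ?_⟩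
  have hbs : ∀ n, IsBispecial L (w n) := fun n => by
    have : w n ∈ Set.range w := Set.mem_range_self n
    rwa [hrange] at this
  have hne : ∀ n, w (n + 1) ≠ [] := fun n h0 => by
    have := hmono (Nat.succ_pos n)
    simp [h0] at this
  choose v hv using fun n => h.exists_eq_lift_of_isBispecial ha (hbs (n + 1)) (hne n)
  have hvb : ∀ n, IsBispecial (ArnouxRauzy.derived L (i 0)) (v n) := fun n => by
    rw [h.isBispecial_derived ha, ← hv]; exact hbs _
  refine ⟨v, ?_, ?_, ?_⟩
  · intro m n hmn
    by_contra! hle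
    have hs := lift_infix (a := i 0)
      ((h.derived ha).right.suffix_of_length_le _ _ (hvb n).1 (hvb m).1 hle).isInfix
    rw [← hv, ← hv] at hs
    exact absurd (hmono (Nat.succ_lt_succ hmn)) (not_lt.2 hs.length_le)
  · ext u
    refine ⟨?_, fun hu => ?_⟩
    · rintro ⟨n, rfl⟩
      exact hvb n
    · obtain ⟨m, hm⟩ : lift (i 0) u ∈ Set.range w := by
        rw [hrange]; exact (h.isBispecial_derived ha).1 hu
      cases m with
      | zero => simp [hw0, lift] at hm
      | succ n =>
        rw [hv] at hm
        exact ⟨n, lift_injective hm⟩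
  · intro n c
    rw [h.isRightSpecial_derived_cons ha, ← hv]
    exact hw (n + 1) c

theorem isIndexSequence_unique (h : IsARLanguage L) {i j : ℕ → Fin k}
    (hi : IsIndexSequence L i) (hj : IsIndexSequence L j) : i = j := by
  funext n
  induction n generalizing L i j with
  | zero =>
    have := h.isRightSpecial_unique (h.isIndexSequence_derived hi).1.1
      (h.isIndexSequence_derived hj).1.1 rfl
    simpa using this
  | succ n ih =>
    have h0 : i 0 = j 0 := by
      have := h.isRightSpecial_unique (h.isIndexSequence_derived hi).1.1
        (h.isIndexSequence_derived hj).1.1 rfl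
      simpa using this
    have hi' := h.isIndexSequence_derived hi
    have hj' := (h.isIndexSequence_derived hj).2
    rw [← h0] at hj'
    exact ih (h.derived hi'.1) hi'.2 hj'

end IsARLanguage

/-! ### Iterated desubstitution and return words -/

/-- The `n`-th desubstitution of `L` along the index sequence `i`. -/
def level (L : Set (List (Fin k))) (i : ℕ → Fin k) : ℕ → Set (List (Fin k))
  | 0 => L
  | n + 1 => derived (level L i n) (i n)

/-- The return word to the `n`-th bispecial word that is coded by the letter `c`. It is the image
of `c` under the product of the first `n` substitutions. -/
def returnWord (i : ℕ → Fin k) : ℕ → Fin k → List (Fin k)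
  | 0, c => [c]
  | n + 1, c => if c = i n then returnWord i n c else returnWord i n (i n) ++ returnWord i n c

/-- The `n`-th bispecial word. -/
def bispecialWord (i : ℕ → Fin k) : ℕ → List (Fin k)
  | 0 => []
  | n + 1 => returnWord i n (i n) ++ bispecialWord i n

/-- The image of a word under the product of the first `n` substitutions. -/
def expand (i : ℕ → Fin k) (n : ℕ) (v : List (Fin k)) : List (Fin k) := v.flatMap (returnWord i n)

@[simp] theorem expand_nil (n : ℕ) : expand i n [] = [] := rfl

@[simp] theorem expand_cons (n : ℕ) (c : Fin k) (v : List (Fin k)) :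
    expand i n (c :: v) = returnWord i n c ++ expand i n v := by
  simp [expand]

@[simp] theorem expand_append (n : ℕ) (u v : List (Fin k)) :
    expand i n (u ++ v) = expand i n u ++ expand i n v := by
  simp [expand]

theorem expand_zero (v : List (Fin k)) : expand i 0 v = v := by
  simp [expand, returnWord]

theorem expand_replicate (n s : ℕ) (c : Fin k) :
    expand i n (List.replicate s c) = wordPow (returnWord i n c) s := by
  simp [expand, wordPow, List.flatMap_def]

theorem returnWord_succ_self (n : ℕ) : returnWord i (n + 1) (i n) = returnWord i n (i n) := by
  simp [returnWord]

theorem returnWord_succ_of_ne {n : ℕ} {c : Fin k} (hc : c ≠ i n) :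
    returnWord i (n + 1) c = returnWord i n (i n) ++ returnWord i n c := by
  simp [returnWord, hc]

theorem expand_succ (n : ℕ) (v : List (Fin k)) :
    expand i (n + 1) v = expand i n (subst (i n) v) := by
  induction v with
  | nil => rfl
  | cons c v ih =>
    by_cases hc : c = i n
    · rw [hc, subst_cons_self, expand_cons, expand_cons, ih, returnWord_succ_self]
    · rw [subst_cons_of_ne hc, expand_cons, expand_cons, expand_cons, ih,
        returnWord_succ_of_ne hc, List.append_assoc]

theorem expand_succ_append (n : ℕ) (v : List (Fin k)) :
    expand i (n + 1) v ++ bispecialWord i (n + 1) =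
      expand i n (lift (i n) v) ++ bispecialWord i n := by
  simp [expand_succ, lift, bispecialWord]

theorem expand_append_mem (n : ℕ) {v : List (Fin k)} (hv : v ∈ level L i n) :
    expand i n v ++ bispecialWord i n ∈ L := by
  induction n generalizing v with
  | zero => rwa [expand_zero, bispecialWord, List.append_nil]
  | succ n ih => rw [expand_succ_append]; exact ih hv

theorem level_spec (h : IsARLanguage L) (hi : IsIndexSequence L i) (n : ℕ) :
    IsARLanguage (level L i n) ∧ IsIndexSequence (level L i n) fun m => i (n + m) := by
  induction n with
  | zero => simpa [level] using ⟨h, hi⟩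
  | succ n ih =>
    have := ih.1.isIndexSequence_derived ih.2
    refine ⟨ih.1.derived this.1, ?_⟩
    simpa [level, Nat.add_assoc, Nat.add_comm 1] using this.2

theorem isSpecialLetter_level (h : IsARLanguage L) (hi : IsIndexSequence L i) (n : ℕ) :
    IsSpecialLetter (level L i n) (i n) := by
  have := level_spec h hi n
  exact (this.1.isIndexSequence_derived this.2).1

theorem length_returnWord_pos (n : ℕ) (c : Fin k) : 0 < (returnWord i n c).length := by
  induction n with
  | zero => simp [returnWord]
  | succ n ih =>
    by_cases hc : c = i n
    · rwa [hc, returnWord_succ_self, ← hc]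
    · rw [returnWord_succ_of_ne hc, List.length_append]; omega

/-- The return word coded by a letter which has already occurred as an index is a prefix of the
bispecial word. This produces the additional period of closed runs. -/
theorem returnWord_prefix (n : ℕ) {c : Fin k} (hc : ∃ m < n, i m = c) :
    returnWord i n c <+: bispecialWord i n := by
  induction n with
  | zero => obtain ⟨m, hm, -⟩ := hc; omega
  | succ n ih =>
    by_cases hcn : c = i n
    · rw [hcn, returnWord_succ_self]; exact List.prefix_append _ _
    · rw [returnWord_succ_of_ne hcn, bispecialWord, List.prefix_append_right_inj]
      obtain ⟨m, hm, hmc⟩ := hc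
      refine ih ⟨m, ?_, hmc⟩
      have : m ≠ n := by rintro rfl; exact hcn hmc.symm
      omega

theorem length_returnWord_of_unused (n : ℕ) {c : Fin k} (hc : ∀ m < n, i m ≠ c) :
    (returnWord i n c).length = (bispecialWord i n).length + 1 := by
  induction n with
  | zero => simp [returnWord, bispecialWord]
  | succ n ih =>
    rw [returnWord_succ_of_ne (hc n (by omega)).symm, bispecialWord]
    simp [ih fun m hm => hc m (by omega)]; omega

/-- The bispecial word has the lengths of all return words as periods; it is shorter than the sum
of any two of them. -/
theorem length_bispecialWord_add_two_le (n : ℕ) {c d : Fin k} (hcd : c ≠ d) :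
    (bispecialWord i n).length + 2 ≤ (returnWord i n c).length + (returnWord i n d).length := by
  induction n with
  | zero => simp [returnWord, bispecialWord]
  | succ n ih =>
    by_cases hc : c = i n <;> by_cases hd : d = i n
    · exact absurd (hc.trans hd.symm) hcd
    · rw [hc, returnWord_succ_self, returnWord_succ_of_ne hd, bispecialWord, ← hc]
      simp only [List.length_append]; omega
    · rw [hd, returnWord_succ_self, returnWord_succ_of_ne hc, bispecialWord, ← hd]
      simp only [List.length_append]; omega
    · rw [returnWord_succ_of_ne hc, returnWord_succ_of_ne hd, bispecialWord]
      simp only [List.length_append]; omega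

/-! ### Runs yield powers -/

theorem lift_replicate_self (c : Fin k) (s : ℕ) :
    lift c (List.replicate s c) = List.replicate (s + 1) c := by
  induction s with
  | zero => rfl
  | succ s ih => rw [List.replicate_succ, lift_cons_self, ih, ← List.replicate_succ]

theorem replicate_mem_level (h : IsARLanguage L) (hi : IsIndexSequence L i) (r n : ℕ) {c : Fin k}
    (hrun : ∀ m, n ≤ m → m < n + r → i m = c) :
    List.replicate (r + 1) c ∈ level L i n := by
  induction r generalizing n with
  | zero => exact (level_spec h hi n).1.singleton_mem c
  | succ r ih =>
    have := ih (n + 1) fun m hm hmr => hrun m (by omega) (by omega)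
    rw [← lift_replicate_self]
    rw [level, hrun n le_rfl (by omega)] at this
    exact this

theorem exists_wordPow_mem_of_isClosedRun (h : IsARLanguage L) (hi : IsIndexSequence L i)
    {r l : ℕ} {c : Fin k} (hrun : IsClosedRun i r c l) :
    ∃ u, u ≠ [] ∧ wordPow u (r + 2) ∈ L := by
  have hused : ∃ m < l, i m = c := by
    by_contra! hno
    exact hrun.2 ⟨hrun.1, hno⟩
  obtain ⟨t, ht⟩ := returnWord_prefix l hused
  refine ⟨returnWord i l c, List.length_pos_iff.1 (length_returnWord_pos l c), ?_⟩
  have := expand_append_mem l (replicate_mem_level h hi r l hrun.1.2)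
  refine h.mem_of_infix this ⟨[], t, ?_⟩
  rw [expand_replicate, ← ht, wordPow, wordPow, List.replicate_succ' (n := r + 1)]
  simp

/-! ### Powers yield runs -/

theorem eq_of_replicate_mem_level (h : IsARLanguage L) (hi : IsIndexSequence L i) {s : ℕ} :
    ∀ {n : ℕ} {c : Fin k}, List.replicate s c ∈ level L i n →
      ∀ m, n ≤ m → m + 1 < n + s → i m = c := by
  induction s with
  | zero => intro n c _ m _ _; omega
  | succ s ih =>
    intro n c hc m hnm hms
    have hn := (level_spec h hi n).1
    obtain rfl : i n = c := by
      have : [c, c] ∈ level L i n := hn.mem_of_infix hc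
        ⟨[], List.replicate (s - 1) c, by
          obtain ⟨t, rfl⟩ : ∃ t, s = t + 1 := ⟨s - 1, by omega⟩
          simp [List.replicate_succ]⟩
      have := hn.eq_or_eq_of_pair_mem (isSpecialLetter_level h hi n) this
      tauto
    rcases hnm.eq_or_lt with rfl | hlt
    · rfl
    · rw [← lift_replicate_self] at hc
      exact ih (n := n + 1) hc m hlt (by omega)

theorem mem_of_prefix_append {v z : List (Fin k)} (hv : v ≠ []) (hz : z <+: v ++ z) :
    ∀ d ∈ z, d ∈ v := by
  induction hn : z.length using Nat.strong_induction_on generalizing z with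
  | _ n ih =>
    rcases List.prefix_or_prefix_of_prefix hz (List.prefix_append v z) with hzv | ⟨t, rfl⟩
    · exact fun d hd => hzv.subset hd
    · rw [List.prefix_append_right_inj] at hz
      have hpos := List.length_pos_iff.2 hv
      intro d hd
      rcases List.mem_append.1 hd with hd | hd
      · exact hd
      · exact ih t.length (by simp at hn; omega) hz rfl d hd

theorem length_expand_mono {n : ℕ} {u v : List (Fin k)} (h : u <:+: v) :
    (expand i n u).length ≤ (expand i n v).length := by
  obtain ⟨s, t, rfl⟩ := h
  simp only [expand_append, List.length_append]
  omega

theorem length_returnWord_add_le {n : ℕ} {v : List (Fin k)} {c d : Fin k} (hc : c ∈ v)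
    (hd : d ∈ v) (hcd : c ≠ d) :
    (returnWord i n c).length + (returnWord i n d).length ≤ (expand i n v).length := by
  obtain ⟨s, t, rfl⟩ := List.append_of_mem hc
  have hd : d ∈ s ++ t := by simp at hd ⊢; tauto
  have := length_expand_mono (i := i) (n := n) (List.singleton_infix_iff d (s ++ t) |>.2 hd)
  simp at this ⊢
  omega

/-- The end of the desubstitution, where the period word is a single letter `c`. The power
`c ^ s` yields a run of `c` of length `s - 1` at position `n`. If `c` occurs before, the run is
closed and `s ≥ p - 1`; otherwise `s ≥ p`, and the run becomes closed when its first term is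
dropped. -/
theorem exists_isClosedRun_of_replicate_mem (h : IsARLanguage L) (hi : IsIndexSequence L i)
    {p s n : ℕ} {c : Fin k} (hp : 3 ≤ p) (hs : List.replicate s c ∈ level L i n)
    (hlen : p * (returnWord i n c).length ≤
      s * (returnWord i n c).length + (bispecialWord i n).length)
    (hc : (bispecialWord i n).length < 2 * (returnWord i n c).length) :
    ∃ (a : Fin k) (l : ℕ), IsClosedRun i (p - 2) a l := by
  have hrun := eq_of_replicate_mem_level h hi hs
  by_cases hused : ∃ m < n, i m = c
  · have hps : p < s + 2 := by
      refine lt_of_mul_lt_mul_right (a := (returnWord i n c).length) ?_ (Nat.zero_le _)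
      rw [add_mul]; omega
    refine ⟨c, n, ⟨by omega, fun m h1 h2 => hrun m h1 (by omega)⟩, fun ho => ?_⟩
    obtain ⟨m, hm, hmc⟩ := hused
    exact ho.2 m hm hmc
  · push Not at hused
    have hW := length_returnWord_of_unused n hused
    have hps : p < s + 1 := by
      refine lt_of_mul_lt_mul_right (a := (returnWord i n c).length) ?_ (Nat.zero_le _)
      rw [add_mul]; omega
    exact ⟨c, n + 1, ⟨by omega, fun m h1 h2 => hrun m (by omega) (by omega)⟩,
      fun ho => ho.2 n (by omega) (hrun n le_rfl (by omega))⟩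

/-- A word `v ++ t` with period word `v` extends to the left to a periodic word that starts
with `a`; the period word undergoes a rotation. -/
theorem exists_periodic_extension_left (h : IsARLanguage L) {a : Fin k} (ha : IsSpecialLetter L a)
    {v t : List (Fin k)} (ht0 : t ≠ []) (hz : v ++ t ∈ L) (ht : t <+: v ++ t) (hv : v ≠ []) :
    ∃ v' t', v'.Perm v ∧ t' ≠ [] ∧ v' ++ t' ∈ L ∧ t' <+: v' ++ t' ∧ [a] <+: v' ++ t' ∧
      v ++ t <:+ v' ++ t' := by
  obtain ⟨b, v1, rfl⟩ := List.exists_cons_of_ne_nil hv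
  by_cases hb : b = a
  · exact ⟨b :: v1, t, .refl _, ht0, hz, ht, by simp [hb], List.suffix_rfl⟩
  · obtain ⟨c, t1, rfl⟩ := List.exists_cons_of_ne_nil ht0
    obtain rfl : c = b := by simpa using (List.cons_prefix_cons.1 ht).1
    obtain ⟨v0, e, hve⟩ : ∃ v0 e, c :: v1 = v0 ++ [e] :=
      ⟨_, _, (List.dropLast_append_getLast (List.cons_ne_nil c v1)).symm⟩
    have hea : e = a := by
      have := h.eq_or_eq_of_pair_mem ha (b := e) (c := c)
        (h.mem_of_infix hz ⟨v0, t1, by rw [hve]; simp⟩)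
      tauto
    subst hea
    have hz' := h.cons_mem ha hb (u := v1 ++ c :: t1) hz
    have heq : e :: c :: (v1 ++ c :: t1) = e :: v0 ++ (e :: c :: t1) := by
      rw [← List.cons_append, hve]; simp
    refine ⟨e :: v0, e :: c :: t1, ?_, by simp, heq ▸ hz', ?_, by simp, ?_⟩
    · rw [hve]; exact (List.perm_append_singleton e v0).symm
    · rw [← heq]; exact List.cons_prefix_cons.2 ⟨rfl, ht⟩
    · rw [← heq]; exact List.suffix_cons _ _

/-- The mirror image of `exists_periodic_extension_left`, where the period word is kept. -/
theorem exists_periodic_extension_right (h : IsARLanguage L) {a : Fin k} (ha : IsSpecialLetter L a)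
    {v t : List (Fin k)} (ht0 : t ≠ []) (hz : v ++ t ∈ L) (ht : t <+: v ++ t) (hv : v ≠ []) :
    ∃ t', v ++ t' ∈ L ∧ t' <+: v ++ t' ∧ [a] <:+ t' ∧ t <+: t' := by
  obtain ⟨t0, b, rfl⟩ : ∃ t0 b, t = t0 ++ [b] :=
    ⟨_, _, (List.dropLast_append_getLast ht0).symm⟩
  by_cases hb : b = a
  · exact ⟨_, hz, ht, by simp [hb], List.prefix_rfl⟩
  · have hz' := h.append_singleton_mem ha hb (u := v ++ t0) (by simpa using hz)
    refine ⟨t0 ++ [b] ++ [a], by simpa using hz', ?_, List.suffix_append _ _,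
      List.prefix_append _ _⟩
    -- The letter which follows the prefix `t0 ++ [b]` of the word can only be `a`.
    obtain ⟨s, hs⟩ := ht
    cases s with
    | nil =>
      rw [List.append_nil, List.self_eq_append_left] at hs
      exact absurd hs hv
    | cons c s =>
      have hbc := h.eq_or_eq_of_pair_mem ha (b := b) (c := c)
        (h.mem_of_infix hz ⟨t0, s, by simpa using hs⟩)
      obtain rfl : c = a := by tauto
      refine ⟨s ++ [c], ?_⟩
      have := congrArg (· ++ [c]) hs
      simpa using this

/-- The induction on the length of the period word `v`. Lengths are those of the words in `L`
coded by `v` and `z`: the factor `z` of the desubstituted language codes a factor of `L` with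
exponent at least `p`. As long as `v` contains two letters, `z` extends to a word of the form
`lift a y`, and `y` has a shorter period word. The hypothesis `hpure` bounds the bispecial word when
`v` is a power of a single letter `c`. It is void as long as `v` contains two letters, and holds when
a desubstitution first makes `v` such a power, since then `c` is not the letter `i n` that has been
removed. -/
theorem exists_isClosedRun_of_periodic (h : IsARLanguage L) (hi : IsIndexSequence L i) {p : ℕ}
    (hp : 3 ≤ p) (n : ℕ) (v z : List (Fin k)) (hv : v ≠ []) (hz : z ∈ level L i n)
    (hper : z <+: v ++ z)
    (hlen : p * (expand i n v).length ≤ (expand i n z).length + (bispecialWord i n).length)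
    (hpure : ∀ c, (∀ d ∈ v, d = c) →
      (bispecialWord i n).length < 2 * (returnWord i n c).length) :
    ∃ (a : Fin k) (l : ℕ), IsClosedRun i (p - 2) a l := by
  induction hN : v.length using Nat.strong_induction_on generalizing n v z with
  | _ N ih =>
    subst hN
    by_cases hall : ∃ c, ∀ d ∈ v, d = c
    · obtain ⟨c, hc⟩ := hall
      have hzc : z = List.replicate z.length c :=
        List.eq_replicate_of_mem fun d hd => hc d (mem_of_prefix_append hv hper d hd)
      refine exists_isClosedRun_of_replicate_mem h hi hp (hzc ▸ hz) ?_ (hpure c hc)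
      obtain ⟨d, v1, rfl⟩ := List.exists_cons_of_ne_nil hv
      obtain rfl := hc d (by simp)
      rw [hzc, expand_replicate] at hlen
      simp only [wordPow, List.length_flatten, List.map_replicate, List.sum_replicate,
        smul_eq_mul, expand_cons, List.length_append] at hlen
      exact (Nat.mul_le_mul_left p (Nat.le_add_right _ _)).trans hlen
    · push Not at hall
      set a := i n with ha_def
      have hL := (level_spec h hi n).1
      have ha : IsSpecialLetter (level L i n) a := isSpecialLetter_level h hi n
      obtain ⟨b, hbv, hba⟩ := hall a
      obtain ⟨c, hcv, hcb⟩ := hall b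
      have hW := length_bispecialWord_add_two_le (i := i) n hcb
      have hv2 := length_returnWord_add_le (i := i) (n := n) hcv hbv hcb
      have hp3 := Nat.mul_le_mul_right (expand i n v).length hp
      have hzv : (expand i n v).length < (expand i n z).length := by omega
      obtain ⟨t, rfl, ht0⟩ : ∃ t, z = v ++ t ∧ t ≠ [] := by
        rcases List.prefix_or_prefix_of_prefix hper (List.prefix_append v z) with hle | ⟨t, rfl⟩
        · exact absurd hzv (not_lt.2 (length_expand_mono hle.isInfix))
        · exact ⟨t, rfl, by rintro rfl; simp at hzv⟩
      rw [List.prefix_append_right_inj] at hper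
      -- The word is extended so that it becomes a concatenation of blocks, followed by `a`.
      obtain ⟨v', t', hperm, ht0', hz', hper', hstart, hext⟩ :=
        exists_periodic_extension_left hL ha ht0 hz hper hv
      have hv' : v' ≠ [] := by rintro rfl; exact hv (List.nil_perm.1 hperm)
      obtain ⟨t'', hz'', hper'', hend, hext'⟩ :=
        exists_periodic_extension_right hL ha ht0' hz' hper' hv'
      have hstart' : [a] <+: v' ++ t'' :=
        hstart.trans ((List.prefix_append_right_inj v').2 hext')
      have hvstart : [a] <+: v' :=
        List.prefix_of_prefix_length_le hstart' (List.prefix_append _ _)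
          (List.length_pos_iff.2 hv')
      have htstart : [a] <+: t'' :=
        List.prefix_of_prefix_length_le hstart' hper'' hend.length_le
      obtain ⟨y, rfl⟩ : ∃ y, v' = subst a y := by
        refine exists_eq_subst v' (hL.isChain_of_mem ha _ (hL.mem_of_infix hz''
          ((List.prefix_append_right_inj v').2 htstart).isInfix)) ?_
        obtain ⟨q, rfl⟩ := hvstart
        rfl
      obtain ⟨x, rfl⟩ := exists_eq_lift (hL.isChain_of_mem ha _ (hL.mem_of_infix hz''
        (List.suffix_append _ _).isInfix)) htstart hend
      rw [← lift_append] at hz'' hper''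
      have hby : b ∈ y := mem_of_mem_subst (hperm.mem_iff.2 hbv) hba
      refine ih y.length ?_ (n + 1) y (y ++ x) ?_ hz'' ?_ ?_ ?_ rfl
      · rw [← hperm.length_eq]
        exact length_lt_length_subst hby hba
      · exact List.ne_nil_of_mem hby
      · exact (List.prefix_append_right_inj y).2 (prefix_of_lift_prefix _ _ hper'')
      · have h1 := congrArg List.length (expand_succ_append (i := i) n (y ++ x))
        simp only [List.length_append, ← ha_def] at h1
        have h2 : (expand i (n + 1) y).length = (expand i n v).length := by
          rw [expand_succ]
          exact (hperm.flatMap_right _).length_eq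
        have h3 : (expand i n (v ++ t)).length ≤ (expand i n (lift a (y ++ x))).length :=
          length_expand_mono (hext.isInfix.trans (by
            rw [lift_append]; exact ((List.prefix_append_right_inj _).2 hext').isInfix))
        rw [h1, h2]
        omega
      · intro d hd
        obtain rfl := hd b hby
        have := length_bispecialWord_add_two_le (i := i) n hba
        rw [returnWord_succ_of_ne hba, bispecialWord]
        simp only [List.length_append, ← ha_def]
        omega

theorem exists_isClosedRun_of_wordPow_mem (h : IsARLanguage L) (hi : IsIndexSequence L i) {p : ℕ}
    (hp : 3 ≤ p) {u : List (Fin k)} (hu : u ≠ []) (hup : wordPow u p ∈ L) :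
    ∃ (a : Fin k) (l : ℕ), IsClosedRun i (p - 2) a l := by
  refine exists_isClosedRun_of_periodic h hi hp 0 u (wordPow u p) hu hup ?_ ?_ ?_
  · refine ⟨u, ?_⟩
    have := congrArg List.flatten
      (List.replicate_succ'.symm.trans (List.replicate_succ (n := p) (a := u)))
    simpa [wordPow] using this
  · simp [expand_zero, wordPow]
  · intro c _
    simp [bispecialWord, returnWord]

/-! ### The language of an Arnoux-Rauzy sequence -/

/-- The words of length `n + 1` with a prefix other than the right-special word `r` of length `n`
are at most as many as the words of length `n` other than `r`. For the complexity to grow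
by `k - 1`, the word `r` has to be followed by all `k` letters. -/
theorem append_singleton_mem_of_complexity (hL : ∀ u v, v ∈ L → u <:+: v → u ∈ L)
    (hcard : ∀ n : ℕ, {u ∈ L | u.length = n}.ncard = (k - 1) * n + 1)
    (huniq : ∀ u v, IsRightSpecial L u → IsRightSpecial L v → u.length = v.length → u = v)
    (r : List (Fin k)) (hr : IsRightSpecial L r) (c : Fin k) : r ++ [c] ∈ L := by
  by_contra hc
  have hfin : ∀ n, {u ∈ L | u.length = n}.Finite := fun n =>
    (List.finite_length_eq (Fin k) n).subset fun u hu => hu.2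
  set A := {u ∈ L | u.length = r.length + 1 ∧ u.dropLast ≠ r}
  set B := {u ∈ L | u.length = r.length + 1 ∧ u.dropLast = r}
  have hA : A.ncard ≤ ({u ∈ L | u.length = r.length} \ {r}).ncard := by
    refine Set.ncard_le_ncard_of_injOn List.dropLast ?_ ?_ ((hfin _).sdiff)
    · rintro u ⟨hu, hun, hur⟩
      exact ⟨⟨hL _ _ hu (List.dropLast_prefix u).isInfix, by simp [hun]⟩, hur⟩
    · rintro u ⟨hu, hun, hur⟩ v ⟨hv, hvn, hvr⟩ huv
      have hu0 : u ≠ [] := by rintro rfl; simp at hun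
      have hv0 : v ≠ [] := by rintro rfl; simp at hvn
      obtain ⟨u, b, rfl⟩ : ∃ u' b, u = u' ++ [b] :=
        ⟨_, _, (List.dropLast_append_getLast hu0).symm⟩
      obtain ⟨v, d, rfl⟩ : ∃ v' d, v = v' ++ [d] :=
        ⟨_, _, (List.dropLast_append_getLast hv0).symm⟩
      simp only [List.dropLast_concat] at huv hur
      subst huv
      by_contra hbd
      refine hur (huniq _ _ ⟨hL _ _ hu (List.prefix_append _ _).isInfix, b, d, ?_, hu, hv⟩ hr
        (by simpa using hun))
      rintro rfl
      exact hbd rfl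
  have hB : B.ncard ≤ ({c}ᶜ : Set (Fin k)).ncard := by
    refine (Set.ncard_le_ncard (t := (fun b => r ++ [b]) '' {c}ᶜ) ?_
      (Set.toFinite _)).trans (Set.ncard_image_le (Set.toFinite _))
    rintro u ⟨hu, hun, hur⟩
    have hu0 : u ≠ [] := by rintro rfl; simp at hun
    have hub : r ++ [u.getLast hu0] = u := by rw [← hur]; exact List.dropLast_append_getLast hu0
    refine ⟨u.getLast hu0, ?_, hub⟩
    rintro hbc
    rw [Set.mem_singleton_iff] at hbc
    rw [hbc] at hub
    exact hc (hub ▸ hu)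
  have hAB : {u ∈ L | u.length = r.length + 1} = A ∪ B := by
    ext u
    simp only [A, B, Set.mem_union, Set.mem_ofPred_eq]
    tauto
  have h1 := Set.ncard_union_le A B
  rw [← hAB, hcard] at h1
  have hrmem : r ∈ {u ∈ L | u.length = r.length} := ⟨hr.1, rfl⟩
  rw [Set.ncard_sdiff_singleton_of_mem hrmem, hcard] at hA
  rw [Set.ncard_compl, Set.ncard_singleton, Nat.card_eq_fintype_card, Fintype.card_fin] at hB
  rw [Nat.mul_add] at h1
  omega

theorem isRightRegular_of_complexity (hL : ∀ u v, v ∈ L → u <:+: v → u ∈ L)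
    (hcard : ∀ n : ℕ, {u ∈ L | u.length = n}.ncard = (k - 1) * n + 1)
    (hspecial : ∀ n : ℕ, ∃! u : List (Fin k), u.length = n ∧ IsRightSpecial L u) :
    IsRightRegular L where
  append_mem := append_singleton_mem_of_complexity hL hcard fun u v hu hv huv =>
    (hspecial v.length).unique ⟨huv, hu⟩ ⟨rfl, hv⟩
  suffix_of_length_le := by
    rintro u v hu ⟨hv, b, c, hbc, hb, hc⟩ huv
    have hs : v.drop (v.length - u.length) <:+ v := List.drop_suffix _ _
    obtain ⟨t, ht⟩ := hs
    have hr : IsRightSpecial L (v.drop (v.length - u.length)) :=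
      ⟨hL _ _ hv ⟨t, [], by simpa using ht⟩, b, c, hbc,
        hL _ _ hb ⟨t, [], by simp [← List.append_assoc, ht]⟩,
        hL _ _ hc ⟨t, [], by simp [← List.append_assoc, ht]⟩⟩
    rw [(hspecial u.length).unique ⟨rfl, hu⟩ ⟨by simp; omega, hr⟩]
    exact ⟨t, ht⟩
  unbounded := fun n => by
    obtain ⟨u, ⟨hn, hu⟩, -⟩ := hspecial n
    exact ⟨u, hu, hn.ge⟩

section factors

variable {ι : Type} [AddMonoidWithOne ι]

@[simp] theorem length_wordAt (x : ι → Fin k) (j : ι) (n : ℕ) : (wordAt x j n).length = n := by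
  simp [wordAt]

theorem wordAt_mem_factors (x : ι → Fin k) (j : ι) (n : ℕ) : wordAt x j n ∈ factors x :=
  ⟨j, by rw [length_wordAt]⟩

theorem wordAt_add (x : ι → Fin k) (j : ι) (m n : ℕ) :
    wordAt x j (m + n) = wordAt x j m ++ wordAt x (j + (m : ι)) n := by
  simp [wordAt, List.ofFn_add, add_assoc]

theorem mem_factors_of_infix (x : ι → Fin k) (u v : List (Fin k)) (hv : v ∈ factors x)
    (huv : u <:+: v) : u ∈ factors x := by
  obtain ⟨s, t, rfl⟩ := huv
  obtain ⟨j, hj⟩ := hv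
  rw [List.length_append, List.length_append, wordAt_add, wordAt_add] at hj
  have h1 := List.append_inj_left hj (by simp)
  have h2 := List.append_inj_right h1 (by simp)
  exact ⟨_, h2⟩

theorem IsARSequence.isARLanguage {x : ι → Fin k} (hx : IsARSequence x) :
    IsARLanguage (factors x) where
  mem_of_infix := mem_factors_of_infix x _ _
  irreducible := fun u hu v hv => by
    obtain ⟨j, hj⟩ := hu
    obtain ⟨G, hG⟩ := hx.uniformlyRecurrent v hv
    obtain ⟨t, -, ht⟩ := hG (j + (u.length : ι))
    refine ⟨wordAt x (j + (u.length : ι)) t, ?_⟩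
    have := wordAt_mem_factors x j (u.length + t + v.length)
    rwa [wordAt_add, wordAt_add, hj, Nat.cast_add, ← add_assoc, ht] at this
  right := isRightRegular_of_complexity (mem_factors_of_infix x) hx.complexity hx.rightSpecial
  left := by
    refine isRightRegular_of_complexity
      (fun u v hv huv => mem_factors_of_infix x _ _ hv (List.reverse_infix.2 huv)) (fun n => ?_)
      fun n => ?_
    · rw [← hx.complexity n, ← Set.ncard_image_of_injective _ List.reverse_injective]
      congr 1
      ext u
      constructor
      · rintro ⟨v, ⟨hv, hn⟩, rfl⟩
        exact ⟨hv, by simpa using hn⟩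
      · rintro ⟨hu, hn⟩
        exact ⟨u.reverse, ⟨by simpa [rev] using hu, by simpa using hn⟩, by simp⟩
    · obtain ⟨u, ⟨hn, hu⟩, huniq⟩ := hx.leftSpecial n
      refine ⟨u.reverse, ⟨by simpa using hn, isRightSpecial_rev.2 (by simpa using hu)⟩, ?_⟩
      rintro v ⟨hvn, hv⟩
      rw [← huniq v.reverse ⟨by simpa using hvn, isRightSpecial_rev.1 hv⟩, List.reverse_reverse]

theorem IsARSubshift.isARLanguage {X : Set (ι → Fin k)} (hX : IsARSubshift X) :
    IsARLanguage (language X) := by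
  obtain ⟨x, hx, rfl⟩ := hX
  have : language {y : ι → Fin k | factors y = factors x} = factors x := by
    ext u
    constructor
    · rintro ⟨y, hy, hu⟩
      exact hy.le hu
    · exact fun hu => ⟨x, rfl, hu⟩
  rw [this]
  exact hx.isARLanguage

end factors

/-! ### The integer index -/

/-- Dropping the first term of an open run of length at least two leaves a closed run. -/
theorem openBound_le_closedBound (i : ℕ → Fin k) : openBound i ≤ closedBound i := by
  have h2 : (2 : ℕ∞) = 1 + 1 := by norm_num
  rw [openBound, closedBound, h2, add_assoc]
  gcongr
  refine iSup₂_le fun r hr => ?_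
  obtain ⟨a, l, ⟨hr1, hrun⟩, hopen⟩ := hr
  obtain ⟨s, rfl⟩ : ∃ s, r = s + 1 := ⟨r - 1, by omega⟩
  rw [Nat.cast_add, Nat.cast_one, add_comm]
  gcongr
  rcases Nat.eq_zero_or_pos s with rfl | hs
  · simp
  · exact le_iSup₂_of_le s ⟨a, l + 1, ⟨hs, fun m h1 h2 => hrun m (by omega) (by omega)⟩,
      fun ho => ho.2 l (by omega) (hrun l le_rfl (by omega))⟩ le_rfl

theorem ind_eq_max {ι : Type} [AddMonoidWithOne ι] {X : Set (ι → Fin k)} (hX : IsARSubshift X)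
    {i : ℕ → Fin k} (hi : IsIndexSequence (language X) i) :
    ind X = max (openBound i) (closedBound i) := by
  have h := hX.isARLanguage
  rw [max_eq_right (openBound_le_closedBound i)]
  apply le_antisymm
  · refine iSup₂_le fun p hp => ?_
    obtain ⟨u, hu, hup⟩ := hp
    rcases Nat.lt_or_ge p 3 with hp3 | hp3
    · exact le_add_right (by exact_mod_cast (by omega : p ≤ 2))
    · have hsub : (p : ℕ∞) = 2 + ((p - 2 : ℕ) : ℕ∞) := by
        exact_mod_cast (by omega : p = 2 + (p - 2))
      rw [hsub, closedBound]
      gcongr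
      exact le_iSup₂_of_le (p - 2) (exists_isClosedRun_of_wordPow_mem h hi hp3 hu hup) le_rfl
  · have h2 : (2 : ℕ∞) ≤ ind X := by
      obtain ⟨a, ha⟩ := h.exists_isSpecialLetter
      exact le_iSup₂_of_le (f := fun (p : ℕ) _ => (p : ℕ∞)) 2
        ⟨[a], by simp, h.right.append_mem [a] ha.1 a⟩ le_rfl
    rw [closedBound, ← add_tsub_cancel_of_le h2]
    gcongr
    refine iSup₂_le fun r hr => ?_
    obtain ⟨a, l, hrun⟩ := hr
    refine ENat.le_sub_of_add_le_left (by simp) ?_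
    refine le_iSup₂_of_le (f := fun (p : ℕ) _ => (p : ℕ∞)) (r + 2)
      (exists_wordPow_mem_of_isClosedRun h hi hrun) ?_
    push_cast
    rw [add_comm]

theorem existsUnique_isIndexSequence {ι : Type} [AddMonoidWithOne ι] {X : Set (ι → Fin k)}
    (hX : IsARSubshift X) : ∃! i, IsIndexSequence (language X) i := by
  obtain ⟨i, hi⟩ := hX.isARLanguage.exists_isIndexSequence
  exact ⟨i, hi, fun j hj => hX.isARLanguage.isIndexSequence_unique hj hi⟩

end ArnouxRauzy

theorem mainTheorem2 (k : ℕ) (hk : 2 ≤ k) :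
    (∀ X : Set (ℕ → Fin k), ArnouxRauzy.IsARSubshift X →
      (∃! i : ℕ → Fin k, ArnouxRauzy.IsIndexSequence (ArnouxRauzy.language X) i) ∧
      ∀ i : ℕ → Fin k, ArnouxRauzy.IsIndexSequence (ArnouxRauzy.language X) i →
        ArnouxRauzy.ind X = max (ArnouxRauzy.openBound i) (ArnouxRauzy.closedBound i)) ∧
    (∀ X : Set (ℤ → Fin k), ArnouxRauzy.IsARSubshift X →
      (∃! i : ℕ → Fin k, ArnouxRauzy.IsIndexSequence (ArnouxRauzy.language X) i) ∧
      ∀ i : ℕ → Fin k, ArnouxRauzy.IsIndexSequence (ArnouxRauzy.language X) i →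
        ArnouxRauzy.ind X = max (ArnouxRauzy.openBound i) (ArnouxRauzy.closedBound i)) :=
  ⟨fun _ hX => ⟨ArnouxRauzy.existsUnique_isIndexSequence hX, fun _ => ArnouxRauzy.ind_eq_max hX⟩,
    fun _ hX => ⟨ArnouxRauzy.existsUnique_isIndexSequence hX, fun _ => ArnouxRauzy.ind_eq_max hX⟩⟩
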